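/- Let $n\ge 0$ be an integer. A signal is a sequence $x=(x(0),x(1),\dots)$ in $\mathbb R^n$, with $\|x\|_\infty=\max_i\sup_t|x_i(t)|\in[0,\infty]$, and $P_Tx=(x(0),\dots,x(T),0,0,\dots)$. A system with $n$ inputs and outputs is a linear operator $H$ on the space of all signals. It is causal if $P_kH=P_kHP_k$ for all $k\ge 0$, and time-invariant if it commutes with the delay $x\mapsto(0,x(0),x(1),\dots)$. Its induced norm is $$\|H\|_{\infty,\infty}=\sup_{t\ge 0}\,\sup_{x\neq 0}\frac{\|P_tHx\|_\infty}{\|P_tx\|_\infty}$$ (with $0/0=0$), and $H$ is $\ell_\infty$-stable if $\|H\|_{\infty,\infty}<\infty$. Let $H_{ij}$ be the scalar system from the $j$-th input to the $i$-th output of $H$; the magnitude matrix of $H$ is $M_H=(\|H_{ij}\|_{\infty,\infty})_{i,j=1}^n$. The feedback interconnection of systems $\mathbf G$ and $\boldsymbol\Delta$ is called stable if $I-\mathbf G\boldsymbol\Delta$ has a causal inverse on the space of all signals and $(I-\mathbf G\boldsymbol\Delta)^{-1}$ is $\ell_\infty$-stable; otherwise it is called unstable. **Theorem.** Let $\mathbf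 G$ be an $\ell_\infty$-stable, causal, linear time-invariant system with $n$ inputs and outputs, and let $\overline\delta_{11},\dots,\overline\delta_{nn}\in\mathbb R$. The following are equivalent: 1. There is an $\ell_\infty$-stable, causal, linear (possibly time-varying) system $\boldsymbol\Delta$ with $n$ inputs and outputs, whose off-diagonal entries are zero and whose diagonal entries satisfy $\|\boldsymbol\delta_{ii}\|_{\infty,\infty}\le\overline\delta_{ii}$ for $i=1,\dots,n$, such that the feedback interconnection of $\mathbf G$ and $\boldsymbol\Delta$ is unstable. 2. There is a diagonal matrix $\Delta\in\mathbb R^{n\times n}$ with non-negative entries and $\delta_{ii}\le\overline\delta_{ii}$ for $i=1,\dots,n$, such that $I-\Delta M_{\mathbf G}$ is singular. -/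

import Mathlib

open scoped ENNReal

noncomputable section

namespace RobustLoop

/-- The extended signal space `ℓ_{∞,e}^n`: sequences `x(0), x(1), …` in `ℝⁿ`. Every truncation of
such a sequence is finitely supported, hence bounded, so all sequences belong to it. -/
abbrev Signal (n : ℕ) : Type := ℕ → Fin n → ℝ

/-- Linear systems with `n` inputs and `n` outputs: linear operators on the extended signal space.
The product is composition and `1` is the identity. -/
abbrev Sys (n : ℕ) : Type := Module.End ℝ (Signal n)

variable {n : ℕ}

/-- The magnitude vector `m_x`: its `i`-th entry is the supremum over time of `|x_i|`. -/
def magVec (x : Signal n) (i : Fin n) : ℝ≥0∞ := ⨆ t, ‖x t i‖ₑ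

/-- The `ℓ_∞` norm of a signal, with value `∞` for unbounded signals. -/
def supNorm (x : Signal n) : ℝ≥0∞ := ⨆ i, magVec x i

/-- The truncation operator `P_T x = (x(0), …, x(T), 0, …)`. -/
def trunc (T : ℕ) : Sys n where
  toFun x t := if t ≤ T then x t else 0
  map_add' x y := by funext t; by_cases h : t ≤ T <;> simp [h]
  map_smul' c x := by funext t; by_cases h : t ≤ T <;> simp [h]

/-- The delay operator `z⁻¹ x = (0, x(0), x(1), …)`. -/
def delay : Sys n where
  toFun x t := if t = 0 then 0 else x (t - 1)
  map_add' x y := by funext t; by_cases h : t = 0 <;> simp [h]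
  map_smul' c x := by funext t; by_cases h : t = 0 <;> simp [h]

/-- Causality: `P_k H = P_k H P_k` for every `k`. -/
def IsCausal (H : Sys n) : Prop := ∀ k, trunc k * H = trunc k * H * trunc k

/-- Time-invariance: `H` commutes with the delay operator. -/
def IsTimeInvariant (H : Sys n) : Prop := H * delay = delay * H

/-- The induced norm `sup_t sup_{x ≠ 0} ‖P_t H x‖_∞ / ‖P_t x‖_∞`. In `ℝ≥0∞` one has `0 / 0 = 0` and
`c / 0 = ∞` for `c ≠ 0`; the numerator vanishes with the denominator if `H` is causal. -/
def gain (H : Sys n) : ℝ≥0∞ :=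
  ⨆ (t : ℕ) (x : Signal n) (_ : x ≠ 0), supNorm (trunc t (H x)) / supNorm (trunc t x)

/-- `ℓ_∞`-stability: the induced norm is finite. -/
def IsStable (H : Sys n) : Prop := gain H < ∞

/-- The signal whose `j`-th channel is the scalar signal `u` and whose other channels vanish. -/
def inject (j : Fin n) : Signal 1 →ₗ[ℝ] Signal n where
  toFun u t := Pi.single j (u t 0)
  map_add' u v := by funext t; simp [Pi.single_add]
  map_smul' c u := by
    funext t i
    by_cases h : i = j
    · subst h; simp
    · simp [h]

/-- The `i`-th channel of a signal, as a scalar signal. -/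
def channel (i : Fin n) : Signal n →ₗ[ℝ] Signal 1 where
  toFun x t _ := x t i
  map_add' _ _ := rfl
  map_smul' _ _ := rfl

/-- The entry `H_ij`: the scalar system from input channel `j` to output channel `i`. -/
def entry (H : Sys n) (i j : Fin n) : Sys 1 := channel i ∘ₗ H ∘ₗ inject j

/-- All entries off the diagonal are zero. -/
def IsDiagonal (H : Sys n) : Prop := ∀ i j, i ≠ j → entry H i j = 0

/-- An entry has at most the norm of the whole system; so the entries of a stable system have
finite norm. -/
theorem gain_entry_le (H : Sys n) (i j : Fin n) : gain (entry H i j) ≤ gain H := by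
  refine iSup_le fun t => iSup_le fun u => iSup_le fun hu => ?_
  have hx : inject j u ≠ 0 := by
    intro h
    apply hu
    funext s k
    have := congrFun (congrFun h s) j
    rw [Subsingleton.elim k 0]
    simpa [inject] using this
  refine le_trans ?_ (le_iSup_of_le t (le_iSup_of_le (inject j u) (le_iSup_of_le hx le_rfl)))
  apply ENNReal.div_le_div
  · refine iSup_le fun k => iSup_le fun s => ?_
    refine le_trans ?_ (le_iSup_of_le i (le_iSup_of_le s le_rfl))
    by_cases hs : s ≤ t <;> simp [trunc, entry, channel, hs]
  · refine iSup_le fun k => iSup_le fun s => ?_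
    refine le_trans ?_ (le_iSup_of_le (0 : Fin 1) (le_iSup_of_le s le_rfl))
    by_cases hs : s ≤ t
    · by_cases hk : k = j
      · subst hk; simp [trunc, inject, hs]
      · simp [trunc, inject, hs, hk]
    · simp [trunc, hs]

/-- The magnitude matrix `M_H`, with entries `‖H_ij‖` (finite if `H` is stable). -/
def magMatrix (H : Sys n) : Matrix (Fin n) (Fin n) ℝ :=
  Matrix.of fun i j => (gain (entry H i j)).toReal

/-- The feedback interconnection of `G` and `Δ` is stable: `(I - G Δ)⁻¹` exists as a causal
operator and is `ℓ_∞`-stable. -/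
def LoopStable (G Δ : Sys n) : Prop :=
  ∃ S : Sys n, IsCausal S ∧ IsStable S ∧ (1 - G * Δ) * S = 1 ∧ S * (1 - G * Δ) = 1

end RobustLoop

end

open scoped ENNReal
open Filter Topology

namespace RobustLoop

/-! ### Truncations, induced norms and channel-wise bounds. -/

section Gain

variable {n : ℕ}

/-! Write `M` for the magnitude matrix of `G`. If `x = e + G Δ x` with `e` bounded by `b` on `[0,
T]`, the vector `X` of channel peaks of `x` on `[0, T]` satisfies `X ≤ b + M D X`, where `D` is the
diagonal matrix of the bounds. If `1 - s D M` is invertible for all `s ∈ [0, 1]`, then continuation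
in `s` yields a solution `w ≥ 1` of `w = 1 + M D w` (`exists_one_le_eq_one_add_mulVec`); no
Perron–Frobenius theory is needed. Comparison with `w` gives `X ≤ b w`, uniformly in `T`, hence a
causal stable inverse.

Conversely, the absolute values `v` of a kernel vector of `1 - D M` satisfy `v ≤ D M v`, so `u = M
v` satisfies `u ≤ M D u`. The entries of `M` are `ℓ₁` norms of impulse responses, so inputs
sign-matched to the kernels over a long block nearly attain them. A constant disturbance `1` covers
the loss and leaves a surplus; serving the channels in rounds of growing amplitude makes `x`
unbounded (`exists_unbounded_response`). Each input `y_j` stays below `d_j` times a sample of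
`|x_j|` that is already available, so `y = Δ x` for a diagonal `Δ` that rescales such samples. -/

theorem trunc_apply (T : ℕ) (x : Signal n) (t : ℕ) :
    trunc T x t = if t ≤ T then x t else 0 := rfl

theorem supNorm_trunc_le_ofReal_iff {T : ℕ} {x : Signal n} {c : ℝ} (hc : 0 ≤ c) :
    supNorm (trunc T x) ≤ ENNReal.ofReal c ↔ ∀ t ≤ T, ∀ i, |x t i| ≤ c := by
  simp only [supNorm, magVec, iSup_le_iff, Real.enorm_eq_ofReal_abs,
    ENNReal.ofReal_le_ofReal_iff hc]
  constructor
  · intro h t ht i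
    simpa [trunc_apply, ht] using h i t
  · intro h i t
    by_cases ht : t ≤ T
    · simpa [trunc_apply, ht] using h t ht i
    · simpa [trunc_apply, ht] using hc

theorem supNorm_trunc_ne_top (T : ℕ) (x : Signal n) : supNorm (trunc T x) ≠ ∞ := by
  refine ne_top_of_le_ne_top (ENNReal.ofReal_ne_top (r := ∑ t ∈ Finset.range (T + 1), ∑ i, |x t i|))
    ((supNorm_trunc_le_ofReal_iff (by positivity)).2 fun t ht i => ?_)
  calc |x t i| ≤ ∑ i, |x t i| :=
        Finset.single_le_sum (f := fun i => |x t i|) (fun _ _ => abs_nonneg _) (Finset.mem_univ i)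
    _ ≤ _ := Finset.single_le_sum (f := fun t => ∑ i, |x t i|)
        (fun _ _ => by positivity) (Finset.mem_range.2 (Nat.lt_succ_of_le ht))

theorem supNorm_trunc_apply_le {H : Sys n} (hH : IsStable H) (T : ℕ) (x : Signal n) :
    supNorm (trunc T (H x)) ≤ gain H * supNorm (trunc T x) := by
  by_cases hx : x = 0
  · subst hx
    simp [supNorm, magVec]
  · rw [← ENNReal.div_le_iff_le_mul (Or.inr hH.ne) (Or.inl (supNorm_trunc_ne_top T x))]
    exact le_iSup_of_le T (le_iSup_of_le x (le_iSup_of_le hx le_rfl))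

theorem abs_apply_le {H : Sys n} (hH : IsStable H) {T : ℕ} {x : Signal n} {c : ℝ} (hc : 0 ≤ c)
    (hx : ∀ t ≤ T, ∀ i, |x t i| ≤ c) {t : ℕ} (ht : t ≤ T) (i : Fin n) :
    |H x t i| ≤ (gain H).toReal * c := by
  have h0 : 0 ≤ (gain H).toReal * c := by positivity
  refine (supNorm_trunc_le_ofReal_iff h0).1 ?_ t ht i
  rw [ENNReal.ofReal_mul ENNReal.toReal_nonneg, ENNReal.ofReal_toReal hH.ne]
  exact (supNorm_trunc_apply_le hH T x).trans
    (mul_le_mul_right ((supNorm_trunc_le_ofReal_iff hc).2 hx) _)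

/-- The input bound is assumed only up to the time at which the output is read, so one estimate
serves every truncation. -/
theorem gain_le_ofReal {H : Sys n} {K : ℝ} (hK : 0 ≤ K)
    (h : ∀ (t : ℕ) (x : Signal n) (c : ℝ), 0 ≤ c → (∀ s ≤ t, ∀ i, |x s i| ≤ c) →
      ∀ i, |H x t i| ≤ K * c) : gain H ≤ ENNReal.ofReal K := by
  refine iSup_le fun T => iSup_le fun x => iSup_le fun _ => ENNReal.div_le_of_le_mul ?_
  set c := (supNorm (trunc T x)).toReal with hc
  have hc0 : 0 ≤ c := ENNReal.toReal_nonneg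
  have hcE : supNorm (trunc T x) = ENNReal.ofReal c :=
    (ENNReal.ofReal_toReal (supNorm_trunc_ne_top T x)).symm
  rw [hcE, ← ENNReal.ofReal_mul hK, supNorm_trunc_le_ofReal_iff (by positivity)]
  intro t ht i
  exact h t x c hc0 (fun s hs => (supNorm_trunc_le_ofReal_iff hc0).1 hcE.le s (hs.trans ht)) i

theorem isCausal_iff {H : Sys n} : IsCausal H ↔
    ∀ (T : ℕ) (x y : Signal n), (∀ t ≤ T, x t = y t) → ∀ t ≤ T, H x t = H y t := by
  constructor
  · intro h T x y hxy t ht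
    have hT : trunc T x = trunc T y := by
      funext s
      by_cases hs : s ≤ T <;> simp [trunc_apply, hs]
      exact hxy s hs
    have h1 := congrFun (LinearMap.congr_fun (h T) x) t
    have h2 := congrFun (LinearMap.congr_fun (h T) y) t
    simp only [Module.End.mul_apply, hT] at h1 h2
    have := h1.trans h2.symm
    simpa [trunc_apply, ht] using this
  · intro h T
    refine LinearMap.ext fun x => funext fun t => ?_
    simp only [Module.End.mul_apply, trunc_apply]
    by_cases ht : t ≤ T
    · simp only [ht, if_true]
      exact h T _ _ (fun s hs => by simp [trunc_apply, hs]) t ht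
    · simp [ht]

theorem sum_inject_channel (x : Signal n) : ∑ j, inject j (channel j x) = x := by
  funext t i
  simp [inject, channel, Finset.sum_apply, Pi.single_apply]

theorem channel_apply_eq_sum (H : Sys n) (x : Signal n) (i : Fin n) :
    channel i (H x) = ∑ j, entry H i j (channel j x) := by
  conv_lhs => rw [← sum_inject_channel x]
  simp [entry]

theorem apply_eq_sum (H : Sys n) (x : Signal n) (t : ℕ) (i : Fin n) :
    H x t i = ∑ j, entry H i j (channel j x) t 0 := by
  have := congrFun (congrFun (channel_apply_eq_sum H x i) t) 0
  simpa [channel, Finset.sum_apply] using this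

theorem channel_apply_of_isDiagonal {H : Sys n} (hH : IsDiagonal H) (x : Signal n) (i : Fin n) :
    channel i (H x) = entry H i i (channel i x) := by
  rw [channel_apply_eq_sum, Finset.sum_eq_single i]
  · intro j _ hj
    simp [hH i j hj.symm]
  · simp

theorem IsStable.entry {H : Sys n} (hH : IsStable H) (i j : Fin n) :
    IsStable (RobustLoop.entry H i j) := (gain_entry_le H i j).trans_lt hH

theorem magMatrix_nonneg (H : Sys n) (i j : Fin n) : 0 ≤ magMatrix H i j := ENNReal.toReal_nonneg

/-- The output of a stable system, channel by channel, in terms of bounds on the input channels. -/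
theorem abs_apply_le_sum_magMatrix {H : Sys n} (hH : IsStable H) {T : ℕ} {x : Signal n}
    {X : Fin n → ℝ} (hX : ∀ i, 0 ≤ X i) (hx : ∀ t ≤ T, ∀ i, |x t i| ≤ X i) {t : ℕ} (ht : t ≤ T)
    (i : Fin n) : |H x t i| ≤ ∑ j, magMatrix H i j * X j := by
  rw [apply_eq_sum]
  refine (Finset.abs_sum_le_sum_abs _ _).trans (Finset.sum_le_sum fun j _ => ?_)
  exact abs_apply_le (hH.entry i j) (hX j) (fun s hs _ => hx s hs j) ht 0

end Gain

/-! ### Impulse responses and their `ℓ₁` norms. -/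

section Kernel

variable {n : ℕ}

/-- The unit impulse in channel `j`. -/
def impulse (j : Fin n) : Signal n := fun t => if t = 0 then Pi.single j 1 else 0

/-- The impulse response of `H` from input channel `j` to output channel `i`. -/
def impulseResponse (H : Sys n) (i j : Fin n) (t : ℕ) : ℝ := H (impulse j) t i

theorem delay_pow_apply (k : ℕ) (x : Signal n) (t : ℕ) :
    (delay ^ k) x t = if t < k then 0 else x (t - k) := by
  induction k generalizing t with
  | zero => simp
  | succ k ih =>
    rw [pow_succ', Module.End.mul_apply]
    change (if t = 0 then 0 else (delay ^ k) x (t - 1)) = _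
    rcases t with _ | t
    · simp
    · simp [ih]

/-- Up to time `t` the input is a finite combination of delayed impulses, and causality discards the
rest; no continuity of `H` is involved. -/
theorem apply_eq_convolution {H : Sys n} (hc : IsCausal H) (hti : IsTimeInvariant H)
    (x : Signal n) (t : ℕ) (i : Fin n) :
    H x t i = ∑ j, ∑ k ∈ Finset.range (t + 1), impulseResponse H i j (t - k) * x k j := by
  have hx : ∀ s ≤ t, x s =
      (∑ j, ∑ k ∈ Finset.range (t + 1), x k j • (delay ^ k) (impulse j) : Signal n) s := by
    intro s hs
    funext i
    simp only [Finset.sum_apply, Pi.smul_apply, smul_eq_mul]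
    have : ∀ j, ∑ k ∈ Finset.range (t + 1), x k j * (delay ^ k) (impulse j) s i
        = if i = j then x s j else 0 := by
      intro j
      rw [Finset.sum_eq_single s]
      · simp [delay_pow_apply, impulse, Pi.single_apply]
      · intro k _ hk
        rw [delay_pow_apply]
        split_ifs with h
        · simp
        · have : s - k ≠ 0 := by omega
          simp [impulse, this]
      · intro h
        exact absurd (Finset.mem_range.2 (Nat.lt_succ_of_le hs)) h
    simp [this]
  have hcomm : ∀ k y, H ((delay ^ k) y) = (delay ^ k) (H y) := fun k y =>
    LinearMap.congr_fun (Commute.pow_right (show Commute H delay from hti) k).eq y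
  rw [isCausal_iff.1 hc t _ _ hx t le_rfl]
  simp only [map_sum, map_smul, hcomm, Finset.sum_apply, Pi.smul_apply, smul_eq_mul]
  refine Finset.sum_congr rfl fun j _ => Finset.sum_congr rfl fun k hk => ?_
  rw [delay_pow_apply, if_neg (by have := Finset.mem_range.1 hk; omega), mul_comm]
  rfl

theorem entry_apply_eq_convolution {H : Sys n} (hc : IsCausal H) (hti : IsTimeInvariant H)
    (i j : Fin n) (u : Signal 1) (t : ℕ) :
    entry H i j u t 0 = ∑ k ∈ Finset.range (t + 1), impulseResponse H i j (t - k) * u k 0 := by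
  change H (inject j u) t i = _
  rw [apply_eq_convolution hc hti, Finset.sum_eq_single j]
  · simp [inject]
  · intro b _ hb
    simp [inject, hb]
  · simp

theorem sum_range_mul_reflect (f y : ℕ → ℝ) (t : ℕ) :
    ∑ k ∈ Finset.range (t + 1), f (t - k) * y k = ∑ k ∈ Finset.range (t + 1), f k * y (t - k) := by
  rw [← Finset.sum_range_reflect]
  refine Finset.sum_congr rfl fun k hk => ?_
  have := Finset.mem_range.1 hk
  rw [show t + 1 - 1 - k = t - k by omega, show t - (t - k) = k by omega]

/-- The time-reversed sign pattern of the kernel is an input of norm at most `1` whose output at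
time `N` is the sum over `k ≤ N`. -/
theorem sum_abs_impulseResponse_le {H : Sys n} (hc : IsCausal H) (hti : IsTimeInvariant H)
    (hs : IsStable H) (i j : Fin n) (N : ℕ) :
    ∑ k ∈ Finset.range N, |impulseResponse H i j k| ≤ (gain (entry H i j)).toReal := by
  refine (Finset.sum_le_sum_of_subset_of_nonneg (Finset.range_mono N.le_succ)
    fun _ _ _ => abs_nonneg _).trans ?_
  let u : Signal 1 := fun k _ => (SignType.sign (impulseResponse H i j (N - k)) : ℝ)
  have hu : ∀ t ≤ N, ∀ i, |u t i| ≤ 1 := by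
    intro t _ _
    simp only [u]
    rcases SignType.sign (impulseResponse H i j (N - t)) with _ | _ | _ <;> simp
  have h := abs_apply_le (hs.entry i j) zero_le_one hu le_rfl 0
  rw [entry_apply_eq_convolution hc hti, mul_one] at h
  refine le_trans (le_of_eq ?_) ((le_abs_self _).trans h)
  rw [← Finset.sum_range_reflect]
  exact Finset.sum_congr rfl fun k _ => (self_mul_sign _).symm

theorem summable_abs_impulseResponse {H : Sys n} (hc : IsCausal H) (hti : IsTimeInvariant H)
    (hs : IsStable H) (i j : Fin n) : Summable fun k => |impulseResponse H i j k| :=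
  summable_of_sum_range_le (fun _ => abs_nonneg _) (sum_abs_impulseResponse_le hc hti hs i j)

/-- The induced norm of a scalar time-invariant system is the `ℓ₁` norm of its impulse response. -/
theorem magMatrix_eq_tsum {H : Sys n} (hc : IsCausal H) (hti : IsTimeInvariant H)
    (hs : IsStable H) (i j : Fin n) :
    magMatrix H i j = ∑' k, |impulseResponse H i j k| := by
  have hsum := summable_abs_impulseResponse hc hti hs i j
  have h0 : 0 ≤ ∑' k, |impulseResponse H i j k| := tsum_nonneg fun _ => abs_nonneg _
  refine le_antisymm ?_ (Real.tsum_le_of_sum_range_le (fun _ => abs_nonneg _)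
    (sum_abs_impulseResponse_le hc hti hs i j))
  refine ENNReal.toReal_le_of_le_ofReal h0 (gain_le_ofReal h0 fun t u c hc0 hu l => ?_)
  rw [Subsingleton.elim l 0, entry_apply_eq_convolution hc hti, sum_range_mul_reflect
    (impulseResponse H i j) fun k => u k 0]
  refine (Finset.abs_sum_le_sum_abs _ _).trans ?_
  calc ∑ k ∈ Finset.range (t + 1), |impulseResponse H i j k * u (t - k) 0|
      ≤ ∑ k ∈ Finset.range (t + 1), |impulseResponse H i j k| * c :=
        Finset.sum_le_sum fun k _ => by
          rw [abs_mul]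
          exact mul_le_mul_of_nonneg_left (hu _ (Nat.sub_le _ _) 0) (abs_nonneg _)
    _ = (∑ k ∈ Finset.range (t + 1), |impulseResponse H i j k|) * c := by rw [Finset.sum_mul]
    _ ≤ _ := mul_le_mul_of_nonneg_right (hsum.sum_le_tsum _ fun _ _ => abs_nonneg _) hc0

end Kernel

/-! ### Comparison vectors for non-negative matrices. -/

section Comparison

variable {n : ℕ}

/-- If `1 - s A` is invertible for all `s ∈ [0, 1]` and `A` has non-negative entries, then the
solution of `w = 1 + A w` is at least `1` in every coordinate. -/
theorem exists_one_le_eq_one_add_mulVec {A : Matrix (Fin n) (Fin n) ℝ} (hA : ∀ i j, 0 ≤ A i j)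
    (h : ∀ s ∈ Set.Icc (0 : ℝ) 1, IsUnit (1 - s • A)) :
    ∃ w : Fin n → ℝ, (∀ i, 1 ≤ w i) ∧ ∀ i, w i = 1 + ∑ j, A i j * w j := by
  let w : ℝ → Fin n → ℝ := fun s => (1 - s • A)⁻¹.mulVec 1
  have hw : ∀ s ∈ Set.Icc (0 : ℝ) 1, ∀ i, w s i = 1 + s * ∑ j, A i j * w s j := by
    intro s hs i
    have h1 : (1 - s • A).mulVec (w s) = 1 := by
      simp only [w, Matrix.mulVec_mulVec]
      rw [Matrix.mul_nonsing_inv _ ((Matrix.isUnit_iff_isUnit_det _).1 (h s hs)),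
        Matrix.one_mulVec]
    have h2 := congrFun h1 i
    rw [Matrix.sub_mulVec, Matrix.one_mulVec, Matrix.smul_mulVec] at h2
    simp only [Pi.sub_apply, Pi.smul_apply, smul_eq_mul, Matrix.mulVec, dotProduct,
      Pi.one_apply] at h2
    linarith
  have hstep : ∀ s ∈ Set.Icc (0 : ℝ) 1, (∀ i, 0 ≤ w s i) → ∀ i, 1 ≤ w s i := by
    intro s hs h0 i
    rw [hw s hs i]
    have : 0 ≤ s * ∑ j, A i j * w s j :=
      mul_nonneg hs.1 (Finset.sum_nonneg fun j _ => mul_nonneg (hA i j) (h0 j))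
    linarith
  have hcont : ContinuousOn w (Set.Icc 0 1) := by
    have hB : Continuous fun s : ℝ => 1 - s • A := by fun_prop
    have hinv : ContinuousOn (fun s : ℝ => (1 - s • A)⁻¹) (Set.Icc 0 1) := by
      simp only [Matrix.inv_def, Ring.inverse_eq_inv']
      refine ContinuousOn.smul (ContinuousOn.inv₀ hB.matrix_det.continuousOn fun s hs => ?_)
        hB.matrix_adjugate.continuousOn
      exact ((Matrix.isUnit_iff_isUnit_det _).1 (h s hs)).ne_zero
    exact (Continuous.matrix_mulVec continuous_id continuous_const).comp_continuousOn hinv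
  have hsub : Set.Icc (0 : ℝ) 1 ⊆ {s | ∀ i, 1 ≤ w s i} := by
    -- Real induction on `s`: `w s ≥ 1` is a closed condition; just to the right of such an `s`,
    -- continuity keeps `w` positive, and `hstep` restores the bound `1`.
    refine IsClosed.Icc_subset_of_forall_mem_nhdsWithin ?_ ?_ ?_
    · have : IsClosed {v : Fin n → ℝ | ∀ i, 1 ≤ v i} := by
        simp only [Set.ofPred_forall]
        exact isClosed_iInter fun i => isClosed_le continuous_const (continuous_apply i)
      have := hcont.preimage_isClosed_of_isClosed isClosed_Icc this
      rwa [Set.inter_comm] at this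
    · intro i
      rw [hw 0 (by simp) i]
      simp
    · rintro s ⟨hs, hs01⟩
      have hopen : IsOpen {v : Fin n → ℝ | ∀ i, 0 < v i} := by
        simp only [Set.ofPred_forall]
        exact isOpen_iInter_of_finite fun i => isOpen_lt continuous_const (continuous_apply i)
      have h1 : w ⁻¹' {v | ∀ i, 0 < v i} ∈ 𝓝[Set.Icc 0 1] s :=
        hcont s ⟨hs01.1, hs01.2.le⟩ (hopen.mem_nhds fun i => zero_lt_one.trans_le (hs i))
      have h2 : Set.Icc (0 : ℝ) 1 ∈ 𝓝[>] s :=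
        mem_of_superset (Ioc_mem_nhdsGT hs01.2) fun y hy => ⟨hs01.1.trans hy.1.le, hy.2⟩
      have h3 : w ⁻¹' {v | ∀ i, 0 < v i} ∈ 𝓝[>] s := nhdsWithin_le_of_mem h2 h1
      filter_upwards [h2, h3] with y hy hy' using hstep y hy fun i => (hy' i).le
  refine ⟨w 1, hsub (by simp), fun i => ?_⟩
  simpa using hw 1 (by simp) i

/-- At an index `k` where `ρ = X k / w k` is maximal, `X ≤ ρ w` gives `ρ w k ≤ b + ρ (w k - 1)`,
that is, `ρ ≤ b`. -/
theorem le_mul_of_le_add_mulVec {A : Matrix (Fin n) (Fin n) ℝ} (hA : ∀ i j, 0 ≤ A i j)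
    {w : Fin n → ℝ} (hw1 : ∀ i, 1 ≤ w i) (hw : ∀ i, w i = 1 + ∑ j, A i j * w j)
    {X : Fin n → ℝ} {b : ℝ} (hX : ∀ i, X i ≤ b + ∑ j, A i j * X j) (i : Fin n) :
    X i ≤ b * w i := by
  have hw0 : ∀ i, 0 < w i := fun i => zero_lt_one.trans_le (hw1 i)
  obtain ⟨k, -, hk⟩ := Finset.exists_max_image Finset.univ (fun i => X i / w i) ⟨i, by simp⟩
  have hle : ∀ j, X j ≤ X k / w k * w j := fun j => by
    rw [← div_le_iff₀ (hw0 j)]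
    exact hk j (by simp)
  have h1 : X k ≤ b + X k / w k * (w k - 1) := by
    refine (hX k).trans ?_
    have h2 : w k - 1 = ∑ j, A k j * w j := by linarith [hw k]
    rw [h2, Finset.mul_sum]
    refine add_le_add_right (Finset.sum_le_sum fun j _ => ?_) b
    calc A k j * X j ≤ A k j * (X k / w k * w j) := mul_le_mul_of_nonneg_left (hle j) (hA k j)
      _ = _ := by ring
  have h2 : X k / w k ≤ b := by
    have : X k / w k * w k = X k := div_mul_cancel₀ _ (hw0 k).ne'
    linarith
  exact (hle i).trans (mul_le_mul_of_nonneg_right h2 (hw0 i).le)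

end Comparison

/-! ### Small-gain stability. -/

section SmallGain

variable {n : ℕ}

/-- A causal `F` such that `F x` controls `x` on every initial interval has a causal stable
inverse. -/
theorem exists_causal_stable_inverse {F : Sys n} (hF : IsCausal F) {C : ℝ} (hC : 0 ≤ C)
    (hbound : ∀ (T : ℕ) (x : Signal n) (b : ℝ), 0 ≤ b → (∀ t ≤ T, ∀ i, |F x t i| ≤ b) →
      ∀ t ≤ T, ∀ i, |x t i| ≤ C * b) :
    ∃ S : Sys n, IsCausal S ∧ IsStable S ∧ F * S = 1 ∧ S * F = 1 := by
  have hinj : ∀ (T : ℕ) (x y : Signal n), (∀ t ≤ T, F x t = F y t) → ∀ t ≤ T, x t = y t := by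
    intro T x y hxy t ht
    funext i
    have h := hbound T (x - y) 0 le_rfl (fun s hs j => by simp [hxy s hs]) t ht i
    rw [mul_zero] at h
    exact sub_eq_zero.1 (abs_nonpos_iff.1 h)
  have hsurjT : ∀ (T : ℕ) (e : Signal n), ∃ x : Signal n, ∀ t ≤ T, F x t = e t := by
    intro T e
    let ext : (Fin (T + 1) → Fin n → ℝ) →ₗ[ℝ] Signal n :=
      { toFun := fun v t => if h : t ≤ T then v ⟨t, Nat.lt_succ_of_le h⟩ else 0
        map_add' := fun u v => by funext t; by_cases h : t ≤ T <;> simp [h]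
        map_smul' := fun c v => by funext t; by_cases h : t ≤ T <;> simp [h] }
    let res : Signal n →ₗ[ℝ] (Fin (T + 1) → Fin n → ℝ) := LinearMap.funLeft ℝ _ Fin.val
    -- On the window `[0, T]` solvability is finite-dimensional: an injective endomorphism is
    -- surjective.
    have hi : Function.Injective (res ∘ₗ F ∘ₗ ext) := by
      intro u v huv
      funext t
      have := hinj T (ext u) (ext v)
        (fun s hs => congrFun huv ⟨s, Nat.lt_succ_of_le hs⟩) t (Nat.le_of_lt_succ t.2)
      simpa [ext, Nat.le_of_lt_succ t.2] using this
    obtain ⟨v, hv⟩ := LinearMap.injective_iff_surjective.1 hi (res e)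
    exact ⟨ext v, fun t ht => congrFun hv ⟨t, Nat.lt_succ_of_le ht⟩⟩
  have hsurj : Function.Surjective F := by
    intro e
    choose x hx using fun T => hsurjT T e
    -- By uniqueness the solutions on different windows agree where they overlap, so the diagonal
    -- glues them.
    refine ⟨fun t => x t t, funext fun T => ?_⟩
    rw [← hx T T le_rfl]
    refine isCausal_iff.1 hF T _ _ (fun t ht => ?_) T le_rfl
    exact hinj t _ _ (fun s hs => (hx t s hs).trans (hx T s (hs.trans ht)).symm) t le_rfl
  have hbij : Function.Bijective F :=
    ⟨fun x y h => funext fun t => hinj t x y (fun s _ => congrFun h s) t le_rfl, hsurj⟩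
  let E := LinearEquiv.ofBijective F hbij
  have hFE : ∀ e, F (E.symm e) = e := fun e => E.apply_symm_apply e
  refine ⟨E.symm.toLinearMap, isCausal_iff.2 fun T x y hxy => ?_, ?_, ?_, ?_⟩
  · exact hinj T _ _ fun s hs => by
      simpa [hFE] using hxy s hs
  · refine (gain_le_ofReal hC fun t e c hc he => ?_).trans_lt ENNReal.ofReal_lt_top
    exact hbound t _ c hc (fun s hs i => by simpa [hFE] using he s hs i) t le_rfl
  · exact LinearMap.ext fun e => hFE e
  · exact LinearMap.ext fun e => E.symm_apply_apply e

theorem loopStable_of_isUnit {G Δ : Sys n} (hGc : IsCausal G) (hGs : IsStable G)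
    (hΔc : IsCausal Δ) (hΔs : IsStable Δ) (hΔd : IsDiagonal Δ) {δ : Fin n → ℝ}
    (hδ : ∀ i, (gain (entry Δ i i)).toReal ≤ δ i)
    (h : ∀ s ∈ Set.Icc (0 : ℝ) 1, IsUnit (1 - s • (Matrix.diagonal δ * magMatrix G))) :
    LoopStable G Δ := by
  have hδ0 : ∀ i, 0 ≤ δ i := fun i => ENNReal.toReal_nonneg.trans (hδ i)
  have hA : ∀ i j, 0 ≤ (magMatrix G * Matrix.diagonal δ) i j := fun i j => by
    rw [Matrix.mul_diagonal]
    exact mul_nonneg (magMatrix_nonneg G i j) (hδ0 j)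
  -- The loop produces `M D` while the hypothesis concerns `D M`; `det (1 - A B) = det (1 - B A)`
  -- exchanges them.
  obtain ⟨w, hw1, hw⟩ := exists_one_le_eq_one_add_mulVec hA fun s hs => by
    have := h s hs
    rw [Matrix.isUnit_iff_isUnit_det] at this ⊢
    rwa [← smul_mul_assoc, Matrix.det_one_sub_mul_comm, mul_smul_comm] at this
  have hw0 : ∀ i, 0 ≤ w i := fun i => zero_le_one.trans (hw1 i)
  have hcausal : IsCausal (1 - G * Δ) := by
    refine isCausal_iff.2 fun T x y hxy t ht => ?_
    have := isCausal_iff.1 hGc T _ _ (isCausal_iff.1 hΔc T x y hxy) t ht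
    simp [hxy t ht, this]
  refine exists_causal_stable_inverse hcausal (C := ∑ i, w i) (Finset.sum_nonneg fun i _ => hw0 i)
    fun T x b hb he => ?_
  have hne : (Finset.range (T + 1)).Nonempty := ⟨0, by simp⟩
  let X : Fin n → ℝ := fun i => (Finset.range (T + 1)).sup' hne fun t => |x t i|
  have hxX : ∀ t ≤ T, ∀ i, |x t i| ≤ X i := fun t ht i =>
    Finset.le_sup' (fun t => |x t i|) (Finset.mem_range.2 (Nat.lt_succ_of_le ht))
  have hX0 : ∀ i, 0 ≤ X i := fun i => (abs_nonneg _).trans (hxX 0 (Nat.zero_le _) i)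
  have hΔx : ∀ t ≤ T, ∀ j, |Δ x t j| ≤ δ j * X j := by
    intro t ht j
    have h1 : Δ x t j = entry Δ j j (channel j x) t 0 :=
      congrFun (congrFun (channel_apply_of_isDiagonal hΔd x j) t) 0
    rw [h1]
    exact (abs_apply_le (hΔs.entry j j) (hX0 j) (fun s hs _ => hxX s hs j) ht 0).trans
      (mul_le_mul_of_nonneg_right (hδ j) (hX0 j))
  have hX : ∀ i, X i ≤ b + ∑ j, (magMatrix G * Matrix.diagonal δ) i j * X j := by
    intro i
    refine Finset.sup'_le _ _ fun t ht => ?_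
    have ht' : t ≤ T := Nat.le_of_lt_succ (Finset.mem_range.1 ht)
    have h1 := abs_apply_le_sum_magMatrix hGs (fun j => mul_nonneg (hδ0 j) (hX0 j)) hΔx ht' i
    have h2 : x t i = (1 - G * Δ) x t i + G (Δ x) t i := by simp
    rw [h2]
    refine (abs_add_le _ _).trans (add_le_add (he t ht' i) (h1.trans_eq ?_))
    exact Finset.sum_congr rfl fun j _ => by rw [Matrix.mul_diagonal]; ring
  intro t ht i
  calc |x t i| ≤ X i := hxX t ht i
    _ ≤ b * w i := le_mul_of_le_add_mulVec hA hw1 hw hX i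
    _ ≤ b * ∑ i, w i := mul_le_mul_of_nonneg_left
        (Finset.single_le_sum (fun i _ => hw0 i) (Finset.mem_univ i)) hb
    _ = _ := mul_comm _ _

end SmallGain

/-! ### Unbounded responses to a bounded disturbance. -/

section Growth

/-- A partial convolution whose last `L` inputs are aligned with the signs of the kernel almost
attains the `ℓ₁` norm of the kernel. -/
theorem mul_le_convolution_of_aligned {f : ℕ → ℝ} (hf : Summable fun k => |f k|) {a : ℝ}
    {y : ℕ → ℝ} {t L : ℕ} (hL : L ≤ t + 1) (hy : ∀ k ≤ t, |y k| ≤ a)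
    (hyL : ∀ k < L, y (t - k) = a * (SignType.sign (f k) : ℝ)) :
    a * (∑' k, |f k| - 2 * (∑' k, |f k| - ∑ k ∈ Finset.range L, |f k|)) ≤
      ∑ k ∈ Finset.range (t + 1), f (t - k) * y k := by
  have ha : 0 ≤ a := (abs_nonneg _).trans (hy 0 (Nat.zero_le _))
  rw [sum_range_mul_reflect]
  have h1 : ∑ k ∈ Finset.range (t + 1), |f k| ≤ ∑' k, |f k| :=
    hf.sum_le_tsum _ fun _ _ => abs_nonneg _
  have h2 : ∑ k ∈ Finset.range (t + 1), (if k < L then |f k| else 0) =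
      ∑ k ∈ Finset.range L, |f k| := by
    rw [← Finset.sum_filter]
    refine Finset.sum_congr (Finset.ext fun k => ?_) fun _ _ => rfl
    simp only [Finset.mem_filter, Finset.mem_range]
    omega
  -- Aligned terms equal `a * |f k|`, all others are at least `-a * |f k|`; the latter cost at most
  -- the tail, once for being absent and once for their sign.
  calc a * (∑' k, |f k| - 2 * (∑' k, |f k| - ∑ k ∈ Finset.range L, |f k|))
      ≤ a * (2 * ∑ k ∈ Finset.range (t + 1), (if k < L then |f k| else 0)
          - ∑ k ∈ Finset.range (t + 1), |f k|) := by
        rw [h2]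
        exact mul_le_mul_of_nonneg_left (by linarith) ha
    _ = ∑ k ∈ Finset.range (t + 1), a * (2 * (if k < L then |f k| else 0) - |f k|) := by
        rw [← Finset.mul_sum, Finset.sum_sub_distrib, Finset.mul_sum]
    _ ≤ _ := by
        refine Finset.sum_le_sum fun k _ => ?_
        split_ifs with h
        · rw [hyL k h]
          refine le_of_eq ?_
          linear_combination -a * self_mul_sign (f k)
        · have h3 : |f k * y (t - k)| ≤ a * |f k| := by
            rw [abs_mul, mul_comm]
            exact mul_le_mul_of_nonneg_right (hy _ (Nat.sub_le _ _)) (abs_nonneg _)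
          linarith [neg_abs_le (f k * y (t - k))]

/-- Every time lies in exactly one of the blocks cut out by a strictly increasing sequence. -/
theorem exists_block {T : ℕ → ℕ} (hT : StrictMono T) (hT0 : T 0 = 0) :
    ∃ b : ℕ → ℕ, (∀ t, T (b t) ≤ t) ∧ (∀ t, t < T (b t + 1)) ∧
      ∀ r t, T r ≤ t → t < T (r + 1) → b t = r := by
  have h : ∀ t, ∃ r, T r ≤ t ∧ t < T (r + 1) := by
    intro t
    induction t with
    | zero => exact ⟨0, hT0.le, hT0.symm.trans_lt (hT zero_lt_one)⟩
    | succ t ih =>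
      obtain ⟨r, h1, h2⟩ := ih
      rcases Nat.lt_or_ge (t + 1) (T (r + 1)) with h3 | h3
      · exact ⟨r, h1.trans t.le_succ, h3⟩
      · have : T (r + 1) < T (r + 1 + 1) := hT (Nat.lt_succ_self (r + 1))
        exact ⟨r + 1, h3, by omega⟩
  choose b hb1 hb2 using h
  refine ⟨b, hb1, hb2, fun r t h1 h2 => le_antisymm ?_ ?_⟩
  · exact Nat.le_of_lt_succ (hT.lt_iff_lt.1 ((hb1 t).trans_lt h2))
  · exact Nat.le_of_lt_succ (hT.lt_iff_lt.1 (h1.trans_lt (hb2 t)))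

variable {n : ℕ}

/-- If `u ≤ M (d u)` for the matrix `M` of `ℓ₁` norms of the kernels `g`, then a unit disturbance
can be amplified without bound by a signal `y` that is dominated by `d` times the past of the
disturbed output. -/
theorem exists_unbounded_response {g : Fin n → Fin n → ℕ → ℝ}
    (hg : ∀ i j, Summable fun k => |g i j k|) {d u : Fin n → ℝ} (hd : ∀ i, 0 ≤ d i)
    (hu : ∀ i, 0 ≤ u i) (hle : ∀ i, u i ≤ ∑ j, (∑' k, |g i j k|) * (d j * u j))
    {c : ℝ} (hc : 0 ≤ c) (hcu : ∀ i, c * u i ≤ 1 / 2) :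
    ∃ y x : Signal n,
      (∀ t i, x t i = (∑ j, ∑ k ∈ Finset.range (t + 1), g i j (t - k) * y k j) + 1) ∧
      (∀ t j, ∃ s ≤ t, |y t j| ≤ d j * |x s j|) ∧ ∀ i (q : ℕ), ∃ t, c * q * u i ≤ x t i := by
  rcases Nat.eq_zero_or_pos n with rfl | hn
  · exact ⟨0, 0, fun _ i => i.elim0, fun _ i => i.elim0, fun i => i.elim0⟩
  -- The input amplitude in round `q`: `d j` times the level `c * q * u j` that `x` reaches in
  -- channel `j` during the preceding round.
  let a : ℕ → Fin n → ℝ := fun q j => c * q * (d j * u j)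
  have ha0 : ∀ q j, 0 ≤ a q j := fun q j =>
    mul_nonneg (mul_nonneg hc q.cast_nonneg) (mul_nonneg (hd j) (hu j))
  have ha_mono : ∀ {p q : ℕ}, p ≤ q → ∀ j, a p j ≤ a q j := fun {p q} hpq j =>
    mul_le_mul_of_nonneg_right (mul_le_mul_of_nonneg_left (Nat.cast_le.2 hpq) hc)
      (mul_nonneg (hd j) (hu j))
  -- Blocks of round `q` are so long that the tails cost at most `1 / 2`. The other half of the
  -- disturbance pays for the increment `c * u i`.
  have hL : ∀ q : ℕ, ∃ L : ℕ, 1 ≤ L ∧ ∀ i,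
      ∑ j, a q j * (2 * (∑' k, |g i j k| - ∑ k ∈ Finset.range L, |g i j k|)) ≤ 1 / 2 := by
    intro q
    have hlim : ∀ i, Tendsto (fun L : ℕ =>
        ∑ j, a q j * (2 * (∑' k, |g i j k| - ∑ k ∈ Finset.range L, |g i j k|))) atTop (𝓝 0) := by
      intro i
      have : ∀ j, Tendsto (fun L : ℕ =>
          a q j * (2 * (∑' k, |g i j k| - ∑ k ∈ Finset.range L, |g i j k|))) atTop (𝓝 0) := by
        intro j
        simpa using (((hg i j).hasSum.tendsto_sum_nat.const_sub
          (∑' k, |g i j k|)).const_mul 2).const_mul (a q j)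
      simpa using tendsto_finsetSum Finset.univ fun j _ => this j
    have hev := eventually_all.2 fun i =>
      (hlim i).eventually_le_const (show (0 : ℝ) < 1 / 2 by norm_num)
    obtain ⟨L, h1, h2⟩ := ((eventually_ge_atTop 1).and hev).exists
    exact ⟨L, h1, h2⟩
  choose L hL1 hL2 using hL
  -- Block `r` starts at `T r`, belongs to round `r / n` and serves output channel `r % n`.
  let T : ℕ → ℕ := fun r => ∑ s ∈ Finset.range r, L (s / n)
  have hTsucc : ∀ r, T (r + 1) = T r + L (r / n) := fun r => Finset.sum_range_succ _ _
  have hT : StrictMono T := strictMono_nat_of_lt_succ fun r => by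
    rw [hTsucc]; exact Nat.lt_add_of_pos_right (hL1 _)
  obtain ⟨b, hb1, hb2, hb3⟩ := exists_block hT rfl
  have hb_mono : Monotone b := fun s t hst =>
    Nat.le_of_lt_succ (hT.lt_iff_lt.1 ((hb1 s).trans_lt (hst.trans_lt (hb2 t))))
  let target : ℕ → Fin n := fun r => ⟨r % n, Nat.mod_lt r hn⟩
  -- The kernel is read backwards from the last instant of the block, where the target channel
  -- peaks.
  let y : Signal n := fun t j =>
    a (b t / n) j * (SignType.sign (g (target (b t)) j (T (b t + 1) - 1 - t)) : ℝ)
  let x : Signal n := fun t i => (∑ j, ∑ k ∈ Finset.range (t + 1), g i j (t - k) * y k j) + 1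
  have hy : ∀ t j, |y t j| ≤ a (b t / n) j := by
    intro t j
    simp only [y, abs_mul, abs_of_nonneg (ha0 _ j)]
    refine mul_le_of_le_one_right (ha0 _ j) ?_
    rcases SignType.sign (g (target (b t)) j (T (b t + 1) - 1 - t)) with _ | _ | _ <;> simp
  have hx : ∀ r, c * ((r / n : ℕ) + 1) * u (target r) ≤ x (T (r + 1) - 1) (target r) := by
    intro r
    set t := T (r + 1) - 1 with ht
    set i := target r with hi
    set q := r / n with hq
    have hTr : T (r + 1) = T r + L q := hTsucc r
    have hLr : 1 ≤ L q := hL1 q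
    have hbt : b t = r := hb3 r t (by omega) (by omega)
    have hj : ∀ j, a q j * (∑' k, |g i j k| -
        2 * (∑' k, |g i j k| - ∑ k ∈ Finset.range (L q), |g i j k|)) ≤
        ∑ k ∈ Finset.range (t + 1), g i j (t - k) * y k j := by
      intro j
      refine mul_le_convolution_of_aligned (hg i j) (y := fun k => y k j) (by omega) ?_ ?_
      · intro k hk
        exact (hy k j).trans (ha_mono (Nat.div_le_div_right ((hb_mono hk).trans_eq hbt)) j)
      · intro k hk
        have hbk : b (t - k) = r := hb3 r _ (by omega) (by omega)
        simp only [y, hbk]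
        rw [show T (r + 1) - 1 - (t - k) = k by omega]
    have h1 : ∑ j, a q j * ∑' k, |g i j k| - 1 / 2 ≤
        ∑ j, ∑ k ∈ Finset.range (t + 1), g i j (t - k) * y k j := by
      refine le_trans ?_ (Finset.sum_le_sum fun j _ => hj j)
      simp only [mul_sub (a q _), Finset.sum_sub_distrib]
      have := hL2 q i
      simp only [mul_sub (a q _), mul_sub (2 : ℝ), Finset.sum_sub_distrib] at this ⊢
      linarith
    have h2 : c * q * u i ≤ ∑ j, a q j * ∑' k, |g i j k| := by
      refine (mul_le_mul_of_nonneg_left (hle i) (mul_nonneg hc q.cast_nonneg)).trans_eq ?_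
      rw [Finset.mul_sum]
      exact Finset.sum_congr rfl fun j _ => by simp only [a]; ring
    have h3 := hcu i
    change _ ≤ (∑ j, ∑ k ∈ Finset.range (t + 1), g i j (t - k) * y k j) + 1
    linarith
  have hx' : ∀ i (q : ℕ), c * (q + 1) * u i ≤ x (T (q * n + i + 1) - 1) i := by
    intro i q
    have h1 : (q * n + i) / n = q := by
      rw [mul_comm, Nat.mul_add_div hn, Nat.div_eq_of_lt i.2, add_zero]
    have h2 : target (q * n + i) = i := Fin.ext (by
      simp only [target]
      rw [mul_comm, Nat.mul_add_mod, Nat.mod_eq_of_lt i.2])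
    have := hx (q * n + i)
    rwa [h1, h2] at this
  refine ⟨y, x, fun _ _ => rfl, fun t j => ?_, fun i q => ⟨_, le_trans ?_ (hx' i q)⟩⟩
  · have hyt := hy t j
    -- In round `0` the input vanishes. In round `q + 1` the sample used is the peak of channel `j`
    -- in round `q`, whose block has already ended.
    rcases hq : b t / n with _ | q
    · refine ⟨t, le_rfl, hyt.trans ?_⟩
      rw [hq]
      simpa [a] using mul_nonneg (hd j) (abs_nonneg (x t j))
    · refine ⟨T (q * n + j + 1) - 1, ?_, hyt.trans ?_⟩
      · have h1 : (q + 1) * n ≤ b t := by rw [← hq]; exact Nat.div_mul_le_self _ _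
        have h2 : q * n + j + 1 ≤ b t := by
          rw [add_mul, one_mul] at h1
          have := j.2
          omega
        exact (Nat.sub_le _ _).trans ((hT.monotone h2).trans (hb1 t))
      · have h1 := mul_le_mul_of_nonneg_left ((hx' j q).trans (le_abs_self _)) (hd j)
        refine le_trans (le_of_eq ?_) h1
        rw [hq]
        simp only [a]
        push_cast
        ring
  · gcongr
    · exact hu i
    · linarith

end Growth

/-! ### The destabilizing diagonal perturbation. -/

section Destabilize

variable {n : ℕ}

/-- The diagonal time-varying system `(Δ x)_j(t) = c_j(t) x_j(σ_j(t))`. -/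
def sampledGain (c : ℕ → Fin n → ℝ) (σ : ℕ → Fin n → ℕ) : Sys n where
  toFun x t j := c t j * x (σ t j) j
  map_add' x y := by funext t j; simp [mul_add]
  map_smul' a x := by funext t j; simp [mul_left_comm]

theorem sampledGain_apply (c : ℕ → Fin n → ℝ) (σ : ℕ → Fin n → ℕ) (x : Signal n) (t : ℕ)
    (j : Fin n) : sampledGain c σ x t j = c t j * x (σ t j) j := rfl

theorem isCausal_sampledGain {c : ℕ → Fin n → ℝ} {σ : ℕ → Fin n → ℕ} (hσ : ∀ t j, σ t j ≤ t) :
    IsCausal (sampledGain c σ) :=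
  isCausal_iff.2 fun T x y hxy t ht => funext fun j => by
    rw [sampledGain_apply, sampledGain_apply, hxy _ ((hσ t j).trans ht)]

theorem isDiagonal_sampledGain (c : ℕ → Fin n → ℝ) (σ : ℕ → Fin n → ℕ) :
    IsDiagonal (sampledGain c σ) := fun i j hij => LinearMap.ext fun u => by
  funext t k
  simp [entry, channel, inject, sampledGain_apply, hij]

theorem isStable_sampledGain {c : ℕ → Fin n → ℝ} {σ : ℕ → Fin n → ℕ} (hσ : ∀ t j, σ t j ≤ t)
    {d : Fin n → ℝ} (hd : ∀ j, 0 ≤ d j) (hc : ∀ t j, |c t j| ≤ d j) :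
    IsStable (sampledGain c σ) := by
  refine (gain_le_ofReal (K := ∑ j, d j) (Finset.sum_nonneg fun j _ => hd j)
    fun t x b hb hx j => ?_).trans_lt ENNReal.ofReal_lt_top
  rw [sampledGain_apply, abs_mul]
  exact mul_le_mul ((hc t j).trans (Finset.single_le_sum (fun j _ => hd j) (Finset.mem_univ j)))
    (hx _ (hσ t j) j) (abs_nonneg _) (Finset.sum_nonneg fun j _ => hd j)

theorem gain_entry_sampledGain_le {c : ℕ → Fin n → ℝ} {σ : ℕ → Fin n → ℕ}
    (hσ : ∀ t j, σ t j ≤ t) {j : Fin n} {d : ℝ} (hd : 0 ≤ d) (hc : ∀ t, |c t j| ≤ d) :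
    (gain (entry (sampledGain c σ) j j)).toReal ≤ d := by
  refine ENNReal.toReal_le_of_le_ofReal hd (gain_le_ofReal hd fun t x b hb hx k => ?_)
  have : entry (sampledGain c σ) j j x t k = c t j * x (σ t j) 0 := by
    simp [entry, channel, inject, sampledGain_apply]
  rw [this, abs_mul]
  exact mul_le_mul (hc t) (hx _ (hσ t j) 0) (abs_nonneg _) hd

theorem not_loopStable_of_unbounded {G Δ : Sys n} {x : Signal n} {C : ℝ} (hC : 0 ≤ C)
    (he : ∀ t i, |(1 - G * Δ) x t i| ≤ C) (hx : ∀ B : ℝ, ∃ t i, B < |x t i|) :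
    ¬ LoopStable G Δ := by
  rintro ⟨S, -, hS, -, hS1⟩
  obtain ⟨t, i, hti⟩ := hx ((gain S).toReal * C)
  have h1 := abs_apply_le hS hC (fun s (_ : s ≤ t) i => he s i) le_rfl i
  have h2 : S ((1 - G * Δ) x) = x := LinearMap.congr_fun hS1 x
  rw [h2] at h1
  exact absurd h1 (not_le.2 hti)

/-- Passing from `v` to `u = M v` turns `v ≤ D M v` into `u ≤ M D u`, and `u` is nonzero because `v
≤ D u`. -/
theorem exists_not_loopStable {G : Sys n} (hGc : IsCausal G) (hGs : IsStable G)
    (hGt : IsTimeInvariant G) {d v : Fin n → ℝ} (hd : ∀ i, 0 ≤ d i) (hv : ∀ i, 0 ≤ v i)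
    (hv0 : ∃ i, v i ≠ 0) (hle : ∀ i, v i ≤ d i * ∑ j, magMatrix G i j * v j) :
    ∃ Δ : Sys n, IsCausal Δ ∧ IsStable Δ ∧ IsDiagonal Δ ∧
      (∀ i, (gain (entry Δ i i)).toReal ≤ d i) ∧ ¬ LoopStable G Δ := by
  obtain ⟨u, hudef⟩ : ∃ u : Fin n → ℝ, ∀ i, u i = ∑ j, magMatrix G i j * v j := ⟨_, fun _ => rfl⟩
  simp only [← hudef] at hle
  have hu : ∀ i, 0 ≤ u i := fun i => hudef i ▸
    Finset.sum_nonneg fun j _ => mul_nonneg (magMatrix_nonneg G i j) (hv j)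
  have hule : ∀ i, u i ≤ ∑ j, (∑' k, |impulseResponse G i j k|) * (d j * u j) := fun i =>
    (hudef i).trans_le <| Finset.sum_le_sum fun j _ => by
      rw [← magMatrix_eq_tsum hGc hGt hGs]
      exact mul_le_mul_of_nonneg_left (hle j) (magMatrix_nonneg G i j)
  obtain ⟨i₀, hi₀⟩ := hv0
  have hui₀ : 0 < u i₀ := by
    refine (hu i₀).lt_of_ne fun h => hi₀ (le_antisymm ?_ (hv i₀))
    have := hle i₀
    rwa [← h, mul_zero] at this
  have hU : 0 < ∑ i, u i := Finset.sum_pos' (fun i _ => hu i) ⟨i₀, Finset.mem_univ _, hui₀⟩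
  obtain ⟨κ, hκ, hκu⟩ : ∃ κ : ℝ, 0 < κ ∧ ∀ i, κ * u i ≤ 1 / 2 := by
    refine ⟨1 / (2 * ∑ i, u i), by positivity, fun i => ?_⟩
    have : u i ≤ ∑ i, u i := Finset.single_le_sum (f := u) (fun i _ => hu i) (Finset.mem_univ i)
    rw [div_mul_eq_mul_div, one_mul, div_le_div_iff₀ (mul_pos two_pos hU) two_pos]
    linarith
  obtain ⟨y, x, hx, hyx, hgrow⟩ := exists_unbounded_response
    (summable_abs_impulseResponse hGc hGt hGs) hd hu hule hκ.le hκu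
  choose σ hσ hy using hyx
  -- Where the sample of `x` vanishes, `hy` forces `y t j = 0`, so the value `0` of the quotient is
  -- the right one.
  let c : ℕ → Fin n → ℝ := fun t j => y t j / x (σ t j) j
  have hcd : ∀ t j, |c t j| ≤ d j := fun t j => by
    rw [abs_div]
    exact div_le_of_le_mul₀ (abs_nonneg _) (hd j) (hy t j)
  have hΔx : sampledGain c σ x = y := by
    funext t j
    rw [sampledGain_apply]
    refine div_mul_cancel_of_imp fun h => ?_
    have := hy t j
    rw [h, abs_zero, mul_zero] at this
    exact abs_nonpos_iff.1 this
  refine ⟨sampledGain c σ, isCausal_sampledGain hσ, isStable_sampledGain hσ hd hcd,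
    isDiagonal_sampledGain c σ, fun j => gain_entry_sampledGain_le hσ (hd j) fun t => hcd t j,
    not_loopStable_of_unbounded (x := x) zero_le_one (fun t i => ?_) fun B => ?_⟩
  · have : (1 - G * sampledGain c σ) x t i = 1 := by
      rw [LinearMap.sub_apply, Module.End.mul_apply, hΔx, Module.End.one_apply, Pi.sub_apply,
        Pi.sub_apply, apply_eq_convolution hGc hGt, hx, add_sub_cancel_left]
    rw [this, abs_one]
  · have hpos : 0 < κ * u i₀ := mul_pos hκ hui₀
    obtain ⟨q, hq⟩ := exists_nat_gt (B / (κ * u i₀))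
    obtain ⟨t, ht⟩ := hgrow i₀ q
    refine ⟨t, i₀, lt_of_lt_of_le ?_ (ht.trans (le_abs_self _))⟩
    rw [div_lt_iff₀ hpos] at hq
    linarith

end Destabilize

end RobustLoop

/-! ### The equivalence. -/

theorem mainTheorem1 (n : ℕ) (G : RobustLoop.Sys n)
    (hG_causal : RobustLoop.IsCausal G) (hG_stable : RobustLoop.IsStable G)
    (hG_ti : RobustLoop.IsTimeInvariant G) (δbar : Fin n → ℝ) :
    (∃ Δ : RobustLoop.Sys n,
        RobustLoop.IsCausal Δ ∧ RobustLoop.IsStable Δ ∧ RobustLoop.IsDiagonal Δ ∧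
        (∀ i, (RobustLoop.gain (RobustLoop.entry Δ i i)).toReal ≤ δbar i) ∧
        ¬ RobustLoop.LoopStable G Δ) ↔
      (∃ D : Matrix (Fin n) (Fin n) ℝ,
        D.IsDiag ∧ (∀ i j, 0 ≤ D i j) ∧ (∀ i, D i i ≤ δbar i) ∧
        ¬ IsUnit (1 - D * RobustLoop.magMatrix G)) := by
  constructor
  · rintro ⟨Δ, hΔc, hΔs, hΔd, hΔ, hunst⟩
    by_contra! hcon
    have hδ0 : ∀ i, 0 ≤ δbar i := fun i => ENNReal.toReal_nonneg.trans (hΔ i)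
    refine hunst (RobustLoop.loopStable_of_isUnit hG_causal hG_stable hΔc hΔs hΔd hΔ fun s hs => ?_)
    -- For `s ∈ [0, 1]` the scaled matrix `s D` is again admissible, so nonsingularity holds along
    -- the whole segment.
    rw [← smul_mul_assoc, ← Matrix.diagonal_smul]
    refine hcon _ (Matrix.isDiag_diagonal _) (fun i j => ?_) fun i => ?_
    · rw [Matrix.diagonal_apply]
      split_ifs
      · exact mul_nonneg hs.1 (hδ0 i)
      · exact le_rfl
    · rw [Matrix.diagonal_apply_eq]
      exact mul_le_of_le_one_left (hδ0 i) hs.2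
  · rintro ⟨D, hDd, hD0, hDle, hsing⟩
    rw [Matrix.isUnit_iff_isUnit_det, isUnit_iff_ne_zero, not_not] at hsing
    obtain ⟨w, hw0, hw⟩ := Matrix.exists_mulVec_eq_zero_iff.2 hsing
    have hwD : ∀ i, w i = D i i * ∑ j, RobustLoop.magMatrix G i j * w j := by
      intro i
      have h := congrFun hw i
      rw [← hDd.diagonal_diag, Matrix.sub_mulVec, Matrix.one_mulVec, ← Matrix.mulVec_mulVec,
        Pi.sub_apply, Matrix.mulVec_diagonal] at h
      exact sub_eq_zero.1 h
    obtain ⟨Δ, h1, h2, h3, h4, h5⟩ := RobustLoop.exists_not_loopStable hG_causal hG_stable hG_ti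
      (d := fun i => D i i) (v := fun i => |w i|) (fun i => hD0 i i) (fun i => abs_nonneg _)
      (by simpa [Function.ne_iff] using hw0) fun i => by
        -- The kernel vector may have mixed signs; the triangle inequality leaves an inequality for
        -- its absolute values, which suffices.
        conv_lhs => rw [hwD i, abs_mul, abs_of_nonneg (hD0 i i)]
        refine mul_le_mul_of_nonneg_left ((Finset.abs_sum_le_sum_abs _ _).trans_eq ?_) (hD0 i i)
        exact Finset.sum_congr rfl fun j _ => by
          rw [abs_mul, abs_of_nonneg (RobustLoop.magMatrix_nonneg G i j)]
    exact ⟨Δ, h1, h2, h3, fun i => (h4 i).trans (hDle i), h5⟩
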